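/- Let $n\ge 1$ robots be points of the Euclidean plane; several robots may occupy the same point. Each robot $r$ has its own fixed local coordinate system, with arbitrary origin, direction and handedness of the axes and unit of length, and a bound $\sigma_r>0$; neither is known to the program or shared between the robots. A deterministic algorithm for anonymous, oblivious robots without communication and with strong multiplicity detection is a single function, common to all robots, that maps the current view of a robot (its own position and the multiset of the positions of all robots, i.e. every occupied point with the exact number of robots on it, all in its local coordinates) to a destination. Time is discrete. At each instant $t=0,1,2,\dots$ a scheduler activates a nonempty set of robots; it is fair, that is, it activates every robot infinitely often (semi-synchronous model). In the step from $t$ to $t+1$ every active robot computes its destination from its view at time $t$ and moves straight towards it, reaching it if it is at distance at most $\sigma_r$ and otherwise travelling exactly the distance $\sigma_r$; the inactive robots stay in place. The algorithm is a self-stabilizing solution of the gathering problem for $n$ robots if, for all local coordinate systems, all bounds $\sigma_r>0$, all fair schedulers and all initial positions (co-located robots allowed), (convergence) after finitely many steps all robots are at the same position, and (closure) if all robots are initially at the same position, then they all remain there forever. **Theorem.** Let $n\ge 1$. There exists a deterministic algorithm with strong multiplicity detection that is a self-stabilizing solution of the gathering problem for $n$ robots if and only if $n$ is odd. -/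

import Mathlib

/-- The Euclidean plane in which the robots move. -/
abbrev Plane : Type := EuclideanSpace ℝ (Fin 2)

/-- The positions of the `n` robots; several robots may occupy the same point. -/
abbrev Config (n : ℕ) : Type := Fin n → Plane

/-- A deterministic program, common to all robots, for oblivious anonymous robots with strong
multiplicity detection. Its inputs are the multiset of all occupied points (the multiplicity of
a point is the number of robots located there) and the observer's own position, both in the
observer's local coordinates; its output is the destination, in the same coordinates. -/
abbrev Algorithm : Type := Multiset Plane → Plane → Plane

/-- The data of the `n` robots that are unknown to the program: for every robot, its local
coordinate system, and a bound on the distance that it travels in one activation. -/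
structure RobotTeam (n : ℕ) where
  /-- `frame i` sends a point of the plane to its coordinates in the local system of robot `i`.
  It is a similarity: origin, direction and handedness of the axes and unit are arbitrary. -/
  frame : Fin n → (Plane ≃ᵈ Plane)
  /-- The distance bound of each robot. -/
  reach : Fin n → ℝ
  reach_pos : ∀ i, 0 < reach i

/-- The view of a robot with coordinate map `φ`: the configuration, with multiplicities and
without identities, expressed in local coordinates. -/
noncomputable def view {n : ℕ} (φ : Plane ≃ᵈ Plane) (c : Config n) : Multiset Plane :=
  (Finset.univ : Finset (Fin n)).val.map (fun j => φ (c j))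

/-- The destination, in global coordinates, that the program `A` gives to robot `i`. -/
noncomputable def destination {n : ℕ} (A : Algorithm) (R : RobotTeam n) (c : Config n) (i : Fin n) : Plane :=
  (R.frame i).symm (A (view (R.frame i) c) (R.frame i (c i)))

/-- Where a robot that starts at `p`, goes straight towards `q` and travels at most the distance
`σ` arrives: at `q` if `q` is within reach, else at the point of the segment at distance `σ`
from `p`. -/
noncomputable def moveTowards (σ : ℝ) (p q : Plane) : Plane :=
  if dist p q ≤ σ then q else AffineMap.lineMap p q (σ / dist p q)

/-- A fair scheduler: a nonempty set of robots is activated at every instant, and every robot is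
activated infinitely often. -/
def FairSchedule {n : ℕ} (active : ℕ → Set (Fin n)) : Prop :=
  (∀ t, (active t).Nonempty) ∧ ∀ i t, ∃ t', t ≤ t' ∧ i ∈ active t'

/-- `c` is an execution of `A` under the activations `active` in the semi-synchronous model: in
the step from `t` to `t + 1` all active robots observe the configuration at time `t`, compute
and move; the inactive ones stay where they are. -/
def IsExecution {n : ℕ} (A : Algorithm) (R : RobotTeam n) (active : ℕ → Set (Fin n))
    (c : ℕ → Config n) : Prop :=
  ∀ t i,
    (i ∈ active t → c (t + 1) i = moveTowards (R.reach i) (c t i) (destination A R (c t) i)) ∧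
    (i ∉ active t → c (t + 1) i = c t i)

/-- All robots are located at the point `p`. -/
def GatheredAt {n : ℕ} (c : Config n) (p : Plane) : Prop :=
  ∀ i, c i = p

/-- Convergence: whatever the team, the fair scheduler and the initial positions, all robots are
at the same position after finitely many steps. -/
def Convergence (n : ℕ) (A : Algorithm) : Prop :=
  ∀ (R : RobotTeam n) (active : ℕ → Set (Fin n)) (c : ℕ → Config n),
    FairSchedule active → IsExecution A R active c → ∃ t p, GatheredAt (c t) p

/-- Closure: if all robots start at the same position, they all stay there. -/
def Closure (n : ℕ) (A : Algorithm) : Prop :=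
  ∀ (R : RobotTeam n) (active : ℕ → Set (Fin n)) (c : ℕ → Config n),
    FairSchedule active → IsExecution A R active c →
      ∀ p, GatheredAt (c 0) p → ∀ t, GatheredAt (c t) p

/-- `A` is a self-stabilizing solution of the gathering problem for `n` robots. -/
def SolvesGathering (n : ℕ) (A : Algorithm) : Prop :=
  Convergence n A ∧ Closure n A

/-! ### Moving towards a point -/

/-! For odd `n` the sum of distances to the robots has exactly one minimizer. By convexity, two
minimizers `x ≠ y` would put every robot on their line, outside the open segment; each robot then
adds `± dist x y` to the difference of the two sums, and an odd number of such terms cannot cancel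
(`IsMedianOf.unique`). Similarities preserve this point, and so do moves towards it
(`IsMedianOf.of_move`), so all robots have one permanent destination and reach it.

For even `n`, start with two equal groups. A program that leaves a robot in place there is frozen
forever by point-symmetric frames (`Convergence.bivalent_moves`). If every robot moves, the
scheduler activates both groups, except when they would meet; then it activates only one, and the
other is not yet at the meeting point (`adversary_ne`). -/

theorem moveTowards_self (σ : ℝ) (hσ : 0 < σ) (p : Plane) : moveTowards σ p p = p := by
  simp [moveTowards, hσ.le]

theorem moveTowards_ne (σ : ℝ) (hσ : 0 < σ) {p q : Plane} (h : q ≠ p) :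
    moveTowards σ p q ≠ p := by
  unfold moveTowards
  split_ifs with hd
  · exact h
  · have hpq : 0 < dist p q := dist_pos.2 h.symm
    rw [Ne, ← dist_eq_zero, dist_lineMap_left]
    have : 0 < σ / dist p q := div_pos hσ hpq
    rw [Real.norm_of_nonneg this.le]
    positivity

/-- A move goes along the segment to the destination. -/
theorem dist_moveTowards_add (σ : ℝ) (hσ : 0 < σ) (p q : Plane) :
    dist p (moveTowards σ p q) + dist (moveTowards σ p q) q = dist p q := by
  unfold moveTowards
  split_ifs with hd
  · simp
  · push Not at hd
    have hpq : 0 < dist p q := hσ.trans hd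
    have h1 : σ / dist p q < 1 := (div_lt_one hpq).2 hd
    have h0 : 0 < σ / dist p q := div_pos hσ hpq
    rw [dist_comm p, dist_lineMap_left, dist_lineMap_right, Real.norm_of_nonneg h0.le,
      Real.norm_of_nonneg (by linarith)]
    ring

theorem dist_moveTowards_right (σ : ℝ) (hσ : 0 < σ) (p q : Plane) :
    dist (moveTowards σ p q) q = max 0 (dist p q - σ) := by
  unfold moveTowards
  split_ifs with hd
  · rw [dist_self, max_eq_left (by linarith)]
  · push Not at hd
    have hpq : 0 < dist p q := hσ.trans hd
    have h1 : σ / dist p q < 1 := (div_lt_one hpq).2 hd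
    rw [dist_lineMap_right, Real.norm_of_nonneg (by linarith), max_eq_right (by linarith)]
    field_simp

/-! ### The geometric median -/

/-- The sum of the distances from `x` to the points of `s`. -/
noncomputable def distSum (s : Multiset Plane) (x : Plane) : ℝ :=
  (s.map fun p => dist p x).sum

/-- `w` minimizes the sum of the distances to the points of `s`. -/
def IsGeometricMedian (s : Multiset Plane) (w : Plane) : Prop :=
  ∀ x, distSum s w ≤ distSum s x

/-- `w` minimizes the sum of the distances to the robots. -/
def IsMedianOf {n : ℕ} (c : Config n) (w : Plane) : Prop :=
  ∀ x, ∑ j, dist (c j) w ≤ ∑ j, dist (c j) x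

theorem distSum_view {n : ℕ} (φ : Plane ≃ᵈ Plane) (c : Config n) (x : Plane) :
    distSum (view φ c) (φ x) = Dilation.ratio φ * ∑ j, dist (c j) x := by
  simp only [distSum, view, Multiset.map_map, Function.comp_def, Dilation.dist_eq,
    Finset.mul_sum]
  rfl

theorem isGeometricMedian_view {n : ℕ} (φ : Plane ≃ᵈ Plane) (c : Config n) (w : Plane) :
    IsGeometricMedian (view φ c) (φ w) ↔ IsMedianOf c w := by
  have hr : (0 : ℝ) < Dilation.ratio φ := Dilation.ratio_pos φ
  unfold IsGeometricMedian IsMedianOf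
  rw [φ.surjective.forall]
  simp only [distSum_view, mul_le_mul_iff_right₀ hr]

theorem exists_isMedianOf {n : ℕ} (hn : 1 ≤ n) (c : Config n) : ∃ w, IsMedianOf c w := by
  have hc : Continuous fun x => ∑ j, dist (c j) x := by fun_prop
  refine hc.exists_forall_le ?_
  refine Filter.tendsto_atTop_mono (fun x => ?_) (tendsto_dist_left_cocompact_atTop (c ⟨0, hn⟩))
  exact Finset.single_le_sum (f := fun j => dist (c j) x) (fun _ _ => dist_nonneg)
    (Finset.mem_univ _)

/-- If the triangle inequality at the midpoint of `x` and `y` is tight as seen from `p`, then `p`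
lies on the line through `x` and `y`, outside the open segment. -/
theorem abs_dist_sub_dist_of_midpoint {p x y : Plane}
    (h : 2 * dist p (midpoint ℝ x y) = dist p x + dist p y) :
    dist p x - dist p y = dist x y ∨ dist p x - dist p y = -dist x y := by
  have hm : 2 * dist p (midpoint ℝ x y) = ‖(p - x) + (p - y)‖ := by
    rw [dist_eq_norm, ← Real.norm_of_nonneg (zero_le_two (α := ℝ)), ← norm_smul]
    congr 1
    rw [midpoint_eq_smul_add, smul_sub, smul_smul]
    norm_num
    rw [two_smul]
    abel
  rw [hm, dist_eq_norm, dist_eq_norm, ← sameRay_iff_norm_add] at h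
  -- For vectors on a common ray, the norm of the difference is the absolute difference of the
  -- norms.
  have h2 := h.norm_sub
  rw [sub_sub_sub_cancel_left, norm_sub_rev, ← dist_eq_norm, ← dist_eq_norm, ← dist_eq_norm] at h2
  rcases abs_choice (dist p x - dist p y) with h3 | h3
  · left; rw [h2, h3]
  · right; rw [h2, h3, neg_neg]

/-- Every term is an odd multiple of `d`, and a sum of oddly many odd integers is odd. -/
theorem sum_ne_zero_of_odd {n : ℕ} (hn : Odd n) {d : ℝ} (hd : d ≠ 0) (f : Fin n → ℝ)
    (hf : ∀ j, f j = d ∨ f j = -d) : ∑ j, f j ≠ 0 := by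
  have hε : ∀ j, ∃ k : ℤ, f j = ((2 * k + 1 : ℤ) : ℝ) * d := fun j => by
    rcases hf j with h | h
    · exact ⟨0, by simp [h]⟩
    · exact ⟨-1, by rw [h]; norm_num⟩
  choose k hk using hε
  simp only [hk, ← Finset.sum_mul]
  refine mul_ne_zero ?_ hd
  rw [← Int.cast_sum, Int.cast_ne_zero, Finset.sum_add_distrib, ← Finset.mul_sum]
  simp only [Finset.sum_const, Finset.card_univ, Fintype.card_fin, nsmul_eq_mul, mul_one]
  obtain ⟨l, rfl⟩ := hn
  push_cast
  omega

/-- An odd number of points has a unique geometric median. -/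
theorem IsMedianOf.unique {n : ℕ} (hn : Odd n) {c : Config n} {x y : Plane}
    (hx : IsMedianOf c x) (hy : IsMedianOf c y) : x = y := by
  by_contra hxy
  have hsum : ∑ j, dist (c j) x = ∑ j, dist (c j) y := le_antisymm (hx y) (hy x)
  have hle : ∀ j, 2 * dist (c j) (midpoint ℝ x y) ≤ dist (c j) x + dist (c j) y := fun j => by
    have := dist_midpoint_midpoint_le (c j) (c j) x y
    rw [midpoint_self] at this
    linarith
  have heq : ∑ j, 2 * dist (c j) (midpoint ℝ x y) = ∑ j, (dist (c j) x + dist (c j) y) := by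
    refine le_antisymm (Finset.sum_le_sum fun j _ => hle j) ?_
    rw [Finset.sum_add_distrib, ← hsum, ← Finset.mul_sum]
    linarith [hx (midpoint ℝ x y)]
  have htight := (Finset.sum_eq_sum_iff_of_le fun j _ => hle j).1 heq
  refine sum_ne_zero_of_odd hn (dist_ne_zero.2 hxy) (fun j => dist (c j) x - dist (c j) y)
    (fun j => abs_dist_sub_dist_of_midpoint (htight j (Finset.mem_univ j))) ?_
  rw [Finset.sum_sub_distrib, hsum, sub_self]

/-- A geometric median remains one when robots move straight towards it. -/
theorem IsMedianOf.of_move {n : ℕ} {c c' : Config n} {w : Plane} (hw : IsMedianOf c w)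
    (h : ∀ j, dist (c j) (c' j) + dist (c' j) w = dist (c j) w) : IsMedianOf c' w := by
  intro x
  -- At any `x` the distance sum drops by at most the total path length; at `w` it drops by exactly
  -- that.
  have h1 : ∑ j, dist (c j) x ≤ ∑ j, dist (c j) (c' j) + ∑ j, dist (c' j) x := by
    rw [← Finset.sum_add_distrib]
    exact Finset.sum_le_sum fun j _ => dist_triangle _ _ _
  have h2 : ∑ j, dist (c j) (c' j) + ∑ j, dist (c' j) w = ∑ j, dist (c j) w := by
    rw [← Finset.sum_add_distrib]
    exact Finset.sum_congr rfl fun j _ => h j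
  linarith [hw x]

/-! ### Gathering at the geometric median -/

open Classical in
/-- The program that sends every robot to a geometric median of the occupied points, counted
with multiplicity. -/
noncomputable def medianAlgorithm : Algorithm := fun s p =>
  if h : ∃ w, IsGeometricMedian s w then h.choose else p

/-- Uniqueness makes the arbitrary choice harmless: whatever the frame, it names the same global
point. -/
theorem destination_medianAlgorithm {n : ℕ} (hn : Odd n) (R : RobotTeam n) {c : Config n}
    {w : Plane} (hw : IsMedianOf c w) (i : Fin n) :
    destination medianAlgorithm R c i = w := by
  have h : ∃ w, IsGeometricMedian (view (R.frame i) c) w :=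
    ⟨_, (isGeometricMedian_view (R.frame i) c w).2 hw⟩
  unfold destination medianAlgorithm
  rw [dif_pos h]
  refine IsMedianOf.unique hn ?_ hw
  rw [← isGeometricMedian_view (R.frame i), DilationEquiv.apply_symm_apply]
  exact h.choose_spec

section Odd

variable {n : ℕ} {R : RobotTeam n} {active : ℕ → Set (Fin n)} {c : ℕ → Config n} {w : Plane}

/-- The geometric median of the initial configuration is invariant. -/
theorem IsExecution.isMedianOf (hn : Odd n) (he : IsExecution medianAlgorithm R active c)
    (hw : IsMedianOf (c 0) w) (t : ℕ) : IsMedianOf (c t) w := by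
  induction t with
  | zero => exact hw
  | succ t ih =>
    refine ih.of_move fun j => ?_
    by_cases hj : j ∈ active t
    · rw [(he t j).1 hj, destination_medianAlgorithm hn R ih]
      exact dist_moveTowards_add _ (R.reach_pos j) _ _
    · rw [(he t j).2 hj, dist_self, zero_add]

theorem IsExecution.dist_median_of_active (hn : Odd n)
    (he : IsExecution medianAlgorithm R active c) (hw : IsMedianOf (c 0) w) {t : ℕ} {i : Fin n}
    (hi : i ∈ active t) : dist (c (t + 1) i) w = max 0 (dist (c t i) w - R.reach i) := by
  rw [(he t i).1 hi, destination_medianAlgorithm hn R (he.isMedianOf hn hw t),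
    dist_moveTowards_right _ (R.reach_pos i)]

theorem IsExecution.antitone_dist_median (hn : Odd n)
    (he : IsExecution medianAlgorithm R active c) (hw : IsMedianOf (c 0) w) (i : Fin n) :
    Antitone fun t => dist (c t i) w := by
  refine antitone_nat_of_succ_le fun t => ?_
  by_cases hi : i ∈ active t
  · rw [he.dist_median_of_active hn hw hi]
    exact max_le dist_nonneg (by linarith [R.reach_pos i])
  · rw [(he t i).2 hi]

/-- After `k` activations of the robot, either it has arrived or it has come closer by `k` times its
reach. -/
theorem IsExecution.exists_dist_median_le (hn : Odd n) (hf : FairSchedule active)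
    (he : IsExecution medianAlgorithm R active c) (hw : IsMedianOf (c 0) w) (i : Fin n) (k : ℕ) :
    ∃ t, dist (c t i) w ≤ max 0 (dist (c 0 i) w - k * R.reach i) := by
  induction k with
  | zero => exact ⟨0, by simp⟩
  | succ k ih =>
    obtain ⟨t, ht⟩ := ih
    obtain ⟨t', htt', hi⟩ := hf.2 i t
    refine ⟨t' + 1, ?_⟩
    rw [he.dist_median_of_active hn hw hi]
    refine max_le (le_max_left _ _) ?_
    have h1 := he.antitone_dist_median hn hw i htt'
    simp only at h1
    rcases le_max_iff.1 (h1.trans ht) with h2 | h2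
    · exact le_max_of_le_left (by linarith [R.reach_pos i])
    · refine le_max_of_le_right ?_
      push_cast
      linarith

theorem IsExecution.eventually_at_median (hn : Odd n) (hf : FairSchedule active)
    (he : IsExecution medianAlgorithm R active c) (hw : IsMedianOf (c 0) w) (i : Fin n) :
    ∀ᶠ t in Filter.atTop, c t i = w := by
  obtain ⟨k, hk⟩ := exists_nat_ge (dist (c 0 i) w / R.reach i)
  rw [div_le_iff₀ (R.reach_pos i)] at hk
  obtain ⟨t, ht⟩ := he.exists_dist_median_le hn hf hw i k
  rw [max_eq_left (by linarith)] at ht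
  refine Filter.eventually_atTop.2 ⟨t, fun s hs => ?_⟩
  exact dist_le_zero.1 ((he.antitone_dist_median hn hw i hs).trans ht)

end Odd

theorem convergence_medianAlgorithm {n : ℕ} (hn : Odd n) : Convergence n medianAlgorithm := by
  intro R active c hf he
  obtain ⟨w, hw⟩ := exists_isMedianOf hn.pos (c 0)
  obtain ⟨t, ht⟩ := (Filter.eventually_all.2 fun i => he.eventually_at_median hn hf hw i).exists
  exact ⟨t, w, ht⟩

theorem closure_medianAlgorithm {n : ℕ} (hn : Odd n) : Closure n medianAlgorithm := by
  intro R active c _ he p hp t i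
  have hw : IsMedianOf (c 0) p := fun x => by
    simp only [hp _, dist_self, Finset.sum_const_zero]
    exact Finset.sum_nonneg fun _ _ => dist_nonneg
  refine dist_le_zero.1 ((he.antitone_dist_median hn hw i t.zero_le).trans ?_)
  simp [hp i]

/-! ### Two groups of equal size never gather -/

section Even

variable {m : ℕ}

/-- One half of the robots at `p`, the other half at `q`. -/
def bivalent (m : ℕ) (p q : Plane) : Config (m + m) := fun i => if i.val < m then p else q

theorem bivalent_rev (p q : Plane) (i : Fin (m + m)) :
    bivalent m p q (Fin.rev i) = bivalent m q p i := by
  have hi := i.isLt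
  unfold bivalent
  rw [Fin.val_rev]
  split_ifs <;> first | rfl | omega

/-- Because the groups have equal size, multiplicities do not tell them apart. -/
theorem view_bivalent_comm (φ : Plane ≃ᵈ Plane) (p q : Plane) :
    view φ (bivalent m p q) = view φ (bivalent m q p) := by
  unfold view
  simp only [← bivalent_rev p q]
  have h := congrArg Finset.val (Finset.map_univ_equiv (Fin.revPerm (n := m + m)))
  rw [Finset.map_val] at h
  conv_lhs => rw [← h]
  rw [Multiset.map_map]
  rfl

theorem map_bivalent (φ : Plane ≃ᵈ Plane) (p q : Plane) :
    view φ (bivalent m p q) = view (DilationEquiv.refl Plane) (bivalent m (φ p) (φ q)) := by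
  unfold view
  refine Multiset.map_congr rfl fun j _ => ?_
  simp only [bivalent, DilationEquiv.refl_apply]
  split_ifs <;> rfl

theorem not_gatheredAt_bivalent (hm : 0 < m) {p q : Plane} (hpq : p ≠ q) (x : Plane) :
    ¬ GatheredAt (bivalent m p q) x := by
  intro h
  have h1 := h ⟨0, by omega⟩
  have h2 := h ⟨m, by omega⟩
  simp only [bivalent, hm, if_true, lt_irrefl, if_false] at h1 h2
  exact hpq (h1.trans h2.symm)

/-- The two halves have frames that differ by the point reflection exchanging `p` and `q`. -/
noncomputable def symmetricTeam (m : ℕ) (p q : Plane) : RobotTeam (m + m) where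
  frame i := if i.val < m then DilationEquiv.refl Plane
    else (IsometryEquiv.subLeft (p + q)).toDilationEquiv
  reach _ := 1
  reach_pos _ := one_pos

/-- A convergent program makes every robot of a bivalent configuration move. -/
theorem Convergence.bivalent_moves (hm : 0 < m) {A : Algorithm} (hA : Convergence (m + m) A)
    {p q : Plane} (hpq : p ≠ q) :
    A (view (DilationEquiv.refl Plane) (bivalent m p q)) p ≠ p := by
  intro hstay
  have hdest : ∀ i, destination A (symmetricTeam m p q) (bivalent m p q) i = bivalent m p q i := by
    intro i
    unfold destination
    rw [DilationEquiv.symm_apply_eq]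
    by_cases hi : i.val < m
    · simp only [symmetricTeam, bivalent, hi, if_true, DilationEquiv.refl_apply]
      exact hstay
    -- The reflection `x ↦ p + q - x` swaps `p` and `q`, so a robot at `q` gets the same input as
    -- one at `p`.
    · rw [map_bivalent, view_bivalent_comm]
      simp only [symmetricTeam, bivalent, hi, if_false, IsometryEquiv.toDilationEquiv_apply,
        IsometryEquiv.subLeft_apply, add_sub_cancel_left, add_sub_cancel_right]
      exact hstay
  obtain ⟨t, x, hx⟩ := hA (symmetricTeam m p q) (fun _ => Set.univ) (fun _ => bivalent m p q)
    ⟨fun _ => ⟨⟨0, by omega⟩, trivial⟩, fun _ t => ⟨t, le_rfl, trivial⟩⟩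
    (fun t i => ⟨fun _ => by rw [hdest, moveTowards_self _ ((symmetricTeam m p q).reach_pos i)],
      fun _ => rfl⟩)
  exact not_gatheredAt_bivalent hm hpq x hx

/-- All robots use the global coordinates and travel at most a unit distance. -/
noncomputable def commonTeam (n : ℕ) : RobotTeam n where
  frame _ := DilationEquiv.refl Plane
  reach _ := 1
  reach_pos _ := one_pos

/-- Where a robot of `commonTeam` located at `x` arrives if it is activated when one half of the
robots is at `s.1` and the other half at `s.2`. -/
noncomputable def arrival (m : ℕ) (A : Algorithm) (s : Plane × Plane) (x : Plane) : Plane :=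
  moveTowards 1 x (A (view (DilationEquiv.refl Plane) (bivalent m s.1 s.2)) x)

open Classical in
/-- The positions of the two halves under the adversary that activates both halves, unless they
would meet; in that case it activates the first half at even and the second at odd times. -/
noncomputable def adversary (m : ℕ) (A : Algorithm) : ℕ → Plane × Plane
  | 0 => (0, EuclideanSpace.single 0 1)
  | t + 1 =>
    let s := adversary m A t
    let a := arrival m A s s.1
    let b := arrival m A s s.2
    if a ≠ b then (a, b) else if Even t then (a, s.2) else (s.1, b)

/-- The activations of `adversary`. -/
def adversaryActive (m : ℕ) (A : Algorithm) (t : ℕ) : Set (Fin (m + m)) :=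
  {i | arrival m A (adversary m A t) (adversary m A t).1 ≠
      arrival m A (adversary m A t) (adversary m A t).2 ∨ (i.val < m ↔ Even t)}

theorem adversary_ne (hm : 0 < m) {A : Algorithm} (hA : Convergence (m + m) A) (t : ℕ) :
    (adversary m A t).1 ≠ (adversary m A t).2 := by
  induction t with
  | zero =>
    intro h
    have := congrArg (fun v : Plane => v 0) h
    simp [adversary] at this
  | succ t ih =>
    have h1 : arrival m A (adversary m A t) (adversary m A t).1 ≠ (adversary m A t).1 :=
      moveTowards_ne 1 one_pos (hA.bivalent_moves hm ih)
    have h2 : arrival m A (adversary m A t) (adversary m A t).2 ≠ (adversary m A t).2 := by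
      refine moveTowards_ne 1 one_pos ?_
      rw [view_bivalent_comm]
      exact hA.bivalent_moves hm ih.symm
    simp only [adversary]
    split_ifs with h3 h4
    · exact h3
    -- The first group moves to the common target, which differs from the second group's position
    -- because that group would move too.
    · rw [not_not] at h3
      simpa only [h3] using h2
    · rw [not_not] at h3
      simpa only [← h3] using h1.symm

theorem fairSchedule_adversaryActive (hm : 0 < m) (A : Algorithm) :
    FairSchedule (adversaryActive m A) := by
  refine ⟨fun t => ?_, fun i t => ?_⟩
  · by_cases ht : Even t
    · exact ⟨⟨0, by omega⟩, Or.inr (by simp [hm, ht])⟩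
    · exact ⟨⟨m, by omega⟩, Or.inr (by simp [ht])⟩
  · by_cases h : i.val < m ↔ Even t
    · exact ⟨t, le_rfl, Or.inr h⟩
    -- Parity alone activates each robot at least every second instant.
    · refine ⟨t + 1, t.le_succ, Or.inr ?_⟩
      rw [Nat.even_add_one]
      tauto

theorem isExecution_adversary (m : ℕ) (A : Algorithm) :
    IsExecution A (commonTeam (m + m)) (adversaryActive m A)
      (fun t => bivalent m (adversary m A t).1 (adversary m A t).2) := by
  have harr : ∀ t i, moveTowards ((commonTeam (m + m)).reach i)
      (bivalent m (adversary m A t).1 (adversary m A t).2 i)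
      (destination A (commonTeam (m + m))
        (bivalent m (adversary m A t).1 (adversary m A t).2) i) =
      arrival m A (adversary m A t) (bivalent m (adversary m A t).1 (adversary m A t).2 i) :=
    fun _ _ => rfl
  intro t i
  simp only [harr]
  by_cases hi : i.val < m <;>
    by_cases hab : arrival m A (adversary m A t) (adversary m A t).1 =
      arrival m A (adversary m A t) (adversary m A t).2 <;>
    by_cases ht : Even t <;>
    simp [adversaryActive, adversary, bivalent, hi, hab, ht]

/-- No program makes an even positive number of robots gather. -/
theorem not_convergence_add_self (hm : 0 < m) (A : Algorithm) : ¬ Convergence (m + m) A := by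
  intro hA
  obtain ⟨t, x, hx⟩ := hA _ _ _ (fairSchedule_adversaryActive hm A) (isExecution_adversary m A)
  exact not_gatheredAt_bivalent hm (adversary_ne hm hA t) x hx

end Even

theorem theorem1 (n : ℕ) (hn : 1 ≤ n) :
    (∃ A : Algorithm, SolvesGathering n A) ↔ Odd n := by
  constructor
  · rintro ⟨A, hA, -⟩
    by_contra hodd
    obtain ⟨m, rfl⟩ := Nat.not_odd_iff_even.1 hodd
    exact not_convergence_add_self (by omega) A hA
  · intro hodd
    exact ⟨medianAlgorithm, convergence_medianAlgorithm hodd, closure_medianAlgorithm hodd⟩
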